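/- Let $G$ be a compact (Hausdorff) group and let $\mathcal A(G)\subseteq C(G)$ be a commutative Banach algebra (for its own norm $\|\cdot\|_{\mathcal A}$) of continuous complex-valued functions on $G$ under pointwise operations such that 1. $\mathcal A(G)$ is regular on $G$: for every closed $F\subseteq G$ and $x\in G\setminus F$ there is $f\in\mathcal A(G)$ with $f|_F=0$ and $f(x)\neq 0$; 2. for all $f\in\mathcal A(G)$ and $s\in G$ the right translate $(R_sf)(x)=f(xs)$ lies in $\mathcal A(G)$, $\|R_sf\|_{\mathcal A}=\|f\|_{\mathcal A}$, and $s\mapsto R_sf$ is continuous from $G$ to $\mathcal A(G)$; 3. $\mathcal T(G)\mathcal A(G)\subseteq\mathcal A(G)$, where $\mathcal T(G)$ is the space of trigonometric polynomials on $G$, i.e. the linear span of the matrix coefficients of the finite-dimensional continuous unitary representations of $G$. Let $K$ be a closed subgroup of $G$, and let $\mathcal A(G:K)=\{f\in\mathcal A(G) : R_kf=f \text{ for all } k\in K\}$. Let $\mathcal A(G/K)$ be the algebra of all functions $sK\mapsto f(s)$ on the space $G/K$ of left cosets (with the quotient topology), $f\in\mathcal A(G:K)$, with the norm that makes $f\mapsto(sK\mapsto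 f(s))$ an isometry of $\mathcal A(G:K)$ onto $\mathcal A(G/K)$. For a Banach algebra $\mathcal A\subseteq C_0(X)$ of functions on a locally compact Hausdorff space $X$ and a closed set $E\subseteq X$, let $I(E)=\{f\in\mathcal A : f|_E=0\}$, let $I_0(E)$ be the set of $f\in\mathcal A$ whose support is compact and disjoint from $E$, and let $J(E)$ be the norm closure of the set of compactly supported elements of $I(E)$. For an integer $d\ge 1$, $E$ is a set of weak synthesis (respectively local weak synthesis) for $\mathcal A$ of degree at most $d$ if $I(E)^d=\overline{I_0(E)}$ (respectively $J(E)^d=\overline{I_0(E)}$), where $I^d$ denotes the closed linear span of all products of $d$ elements of $I$. Let $E\subseteq G/K$ be closed and $E^*=\{s\in G : sK\in E\}$. Then for every integer $d\ge 1$: (a) $E$ is a set of weak synthesis for $\mathcal A(G/K)$ of degree at most $d$ if and only if $E^*$ is a set of weak synthesis for $\mathcal A(G)$ of degree at most $d$; (b) $E$ is a set of local weak synthesis for $\mathcal A(G/K)$ of degree at most $d$ if and only if $E^*$ is a set of local weak synthesis for $\mathcal A(G)$ of degree at most $d$. -/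

import Mathlib

open scoped ZeroAtInfty

/- Throughout, a Banach algebra of functions contained in `C₀(X)` is a complex commutative Banach
algebra `A` (not assumed unital) together with an injective algebra homomorphism
`ι : A → C₀(X, ℂ)`; the function on `X` given by `f : A` is `ι f`, and the norm of `A` is its
own (not the uniform norm). -/

namespace Synthesis

section FunctionAlgebra

variable {X : Type*} [TopologicalSpace X]
variable {A : Type*} [NonUnitalNormedCommRing A] [NormedSpace ℂ A]

/-- `A` is regular on `X`: its functions separate points from closed sets. -/
def IsRegularOn (ι : A →ₙₐ[ℂ] C₀(X, ℂ)) : Prop :=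
  ∀ F : Set X, IsClosed F → ∀ x, x ∉ F → ∃ f : A, (∀ y ∈ F, ι f y = 0) ∧ ι f x ≠ 0

/-- `I(E)`: the elements of `A` that vanish on `E`. -/
def vanishing (ι : A →ₙₐ[ℂ] C₀(X, ℂ)) (E : Set X) : Set A :=
  {f | ∀ x ∈ E, ι f x = 0}

/-- `I₀(E)`: the elements of `A` with compact support disjoint from `E`. -/
def vanishingNear (ι : A →ₙₐ[ℂ] C₀(X, ℂ)) (E : Set X) : Set A :=
  {f | Disjoint (tsupport (ι f)) E ∧ HasCompactSupport (ι f)}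

/-- `J(E)`: the norm closure of the compactly supported elements of `I(E)`. -/
def localVanishing (ι : A →ₙₐ[ℂ] C₀(X, ℂ)) (E : Set X) : Set A :=
  closure {f | f ∈ vanishing ι E ∧ HasCompactSupport (ι f)}

/-- `IsProductOf S d a`: the element `a` is a product of `d ≥ 1` elements of `S`. -/
inductive IsProductOf (S : Set A) : ℕ → A → Prop
  | one (f : A) : f ∈ S → IsProductOf S 1 f
  | mul (d : ℕ) (f g : A) : IsProductOf S d f → g ∈ S → IsProductOf S (d + 1) (f * g)

/-- The `d`-th power (`d ≥ 1`) of a closed ideal `S`, as a closed ideal: the closed linear span of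
all products of `d` elements of `S`. -/
def closedPower (S : Set A) (d : ℕ) : Set A :=
  closure (Submodule.span ℂ {a : A | IsProductOf S d a} : Set A)

/-- `E` is a set of weak synthesis for `A` of degree at most `d` (`d ≥ 1`):
`I(E)^d` is the closure of `I₀(E)`. -/
def IsWeakSynthesis (ι : A →ₙₐ[ℂ] C₀(X, ℂ)) (E : Set X) (d : ℕ) : Prop :=
  closedPower (vanishing ι E) d = closure (vanishingNear ι E)

/-- `E` is a set of local weak synthesis for `A` of degree at most `d` (`d ≥ 1`):
`J(E)^d` is the closure of `I₀(E)`. -/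
def IsLocalWeakSynthesis (ι : A →ₙₐ[ℂ] C₀(X, ℂ)) (E : Set X) (d : ℕ) : Prop :=
  closedPower (localVanishing ι E) d = closure (vanishingNear ι E)

end FunctionAlgebra

section Group

variable {G : Type*} [Group G] [TopologicalSpace G]

/-- The trigonometric polynomials on `G`: the linear span of the matrix coefficients of the
finite-dimensional continuous unitary representations of `G`. -/
def trigPoly (G : Type*) [Group G] [TopologicalSpace G] : Submodule ℂ (G → ℂ) :=
  Submodule.span ℂ {t | ∃ (n : ℕ) (π : G →* Matrix.unitaryGroup (Fin n) ℂ),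
    Continuous π ∧ ∃ i j : Fin n, t = fun g => (π g : Matrix (Fin n) (Fin n) ℂ) i j}

variable {A : Type*} [NonUnitalNormedCommRing A] [NormedSpace ℂ A]

/-- `A` is closed under the right translations `(R_s f)(x) = f (x s)`, these are isometric on `A`,
and `s ↦ R_s f` is norm continuous for every `f ∈ A`. -/
def HasContinuousIsometricRightTranslations (ι : A →ₙₐ[ℂ] C₀(G, ℂ)) : Prop :=
  ∀ f : A, ∃ R : G → A,
    (∀ s x, ι (R s) x = ι f (x * s)) ∧ (∀ s, ‖R s‖ = ‖f‖) ∧ Continuous R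

/-- The space of trigonometric polynomials multiplies `A` into `A`. -/
def IsTrigPolyModule (ι : A →ₙₐ[ℂ] C₀(G, ℂ)) : Prop :=
  ∀ t ∈ trigPoly G, ∀ f : A, ∃ g : A, ∀ x, ι g x = t x * ι f x

/-- `A(G:K)`: the subalgebra of those `f ∈ A` with `R_k f = f` for all `k ∈ K`, with the norm
of `A`. -/
def rightInvariant (ι : A →ₙₐ[ℂ] C₀(G, ℂ)) (K : Subgroup G) : NonUnitalSubalgebra ℂ A where
  carrier := {f | ∀ k ∈ K, ∀ x, ι f (x * k) = ι f x}
  add_mem' {f g} hf hg k hk x := by simp [hf k hk x, hg k hk x]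
  zero_mem' k _ x := by simp
  mul_mem' {f g} hf hg k hk x := by simp [hf k hk x, hg k hk x]
  smul_mem' c f hf k hk x := by simp [hf k hk x]

/-- `A(G:K)` carries the norm of `A`. -/
instance instNormedSpaceRightInvariant (ι : A →ₙₐ[ℂ] C₀(G, ℂ)) (K : Subgroup G) :
    NormedSpace ℂ (rightInvariant ι K) where
  norm_smul_le c f := norm_smul_le c (f : A)

/-- The map `M : A(G:K) → C(G/K)`, `M f (sK) = f s`, for compact `G`. Its range, with the norm
that makes `M` an isometry, is `A(G/K)`; so `A(G/K)` is the Banach algebra `A(G:K)` regarded as an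
algebra of functions on `G/K` by means of `M`. -/
noncomputable def cosetMap [CompactSpace G] (ι : A →ₙₐ[ℂ] C₀(G, ℂ)) (K : Subgroup G) :
    rightInvariant ι K →ₙₐ[ℂ] C₀(G ⧸ K, ℂ) where
  toFun f :=
    { toFun := Quotient.lift (fun s => ι (f : A) s) (by
        intro a b hab
        have h := f.2 (a⁻¹ * b) (QuotientGroup.leftRel_apply.mp hab) a
        rw [mul_inv_cancel_left] at h
        exact h.symm)
      continuous_toFun := Continuous.quotient_lift (map_continuous (ι (f : A))) _
      zero_at_infty' := by simp [Filter.cocompact_eq_bot] }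
  map_smul' c f := by
    ext x; induction x using QuotientGroup.induction_on with | H s => simp [QuotientGroup.mk]
  map_zero' := by
    ext x; induction x using QuotientGroup.induction_on with | H s => simp [QuotientGroup.mk]
  map_add' f g := by
    ext x; induction x using QuotientGroup.induction_on with | H s => simp [QuotientGroup.mk]
  map_mul' f g := by
    ext x; induction x using QuotientGroup.induction_on with | H s => simp [QuotientGroup.mk]

end Group

end Synthesis

/-! Let `P` be averaging of right translates over normalized Haar measure `ν` of `K`. It is a
contractive projection of `A` onto `A(G:K)`; it preserves `I(E*)`, and also `I₀(E*)` because `K` is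
compact. Synthesis on `G` therefore descends to `G/K`: apply `P` to the approximants of an invariant
function.

The converse rests on `vanishing_subset_multiplesOfProducts`: `I(E)`, lifted to `G`, generates
`I(E*)` as a closed ideal. For a trigonometric polynomial `t`, the averages `∫ t(k) R_k f dν(k)`
approximate `f`. When `t` is a matrix coefficient of `π`, the identity `π(k) = π(x)* π(xk)` turns
such an average into a finite sum `∑ a_l P(b_l f)`, where `a_l` and `b_l` are coefficients (`a_l`
conjugated). If `f` vanishes on `E*`, each `P(b_l f)` belongs to the lift of `I(E)`. Taking powers,
`I(E*)^d` lies in the closed ideal generated by `I(E)^d`, and the closure of `I₀(E*)` is an ideal.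

The inclusion of `I₀` in `I^d` is automatic on both sides: normality (`exists_eqOn_one_eqOn_zero`)
supplies local units. The approximation and normality arguments use the Peter–Weyl theorem, obtained
here from the spectral theorem for compact convolution operators. Since `G` is compact, local and
ordinary weak synthesis coincide. -/

namespace Synthesis

open MeasureTheory Topology

/-! ### Hermitian kernel operators on a compact space. -/

section KernelOperator

variable {X : Type*} [TopologicalSpace X] [CompactSpace X]

section

variable {H : Type*} [NormedAddCommGroup H] [InnerProductSpace ℂ H]

/-- The operator `f ↦ (x ↦ ⟪Φ x, f⟫)` from a Hilbert space to the continuous functions on a compact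
space. -/
noncomputable def innerOperator (Φ : C(X, H)) : H →L[ℂ] C(X, ℂ) :=
  LinearMap.mkContinuous
    { toFun := fun f => ⟨fun x => inner ℂ (Φ x) f, by fun_prop⟩
      map_add' := fun f g => by ext x; exact inner_add_right _ _ _
      map_smul' := fun c f => by ext x; exact inner_smul_right _ _ _ } ‖Φ‖ (fun f => by
    rw [ContinuousMap.norm_le _ (by positivity)]
    exact fun x => (norm_inner_le_norm _ _).trans
      (mul_le_mul_of_nonneg_right (Φ.norm_coe_le_norm x) (norm_nonneg f)))

/-- Arzelà–Ascoli: by Cauchy–Schwarz the image of the unit ball is bounded by `‖Φ‖` and inherits its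
equicontinuity from the continuity of `Φ`. -/
theorem isCompactOperator_innerOperator (Φ : C(X, H)) : IsCompactOperator (innerOperator Φ) := by
  rw [isCompactOperator_iff_exists_mem_nhds_isCompact_closure_image]
  refine ⟨Metric.closedBall 0 1, Metric.closedBall_mem_nhds _ one_pos, ?_⟩
  let L := ContinuousMap.linearIsometryBoundedOfCompact X ℂ ℂ
  have key : IsCompact (closure (L '' (innerOperator Φ '' Metric.closedBall 0 1))) := by
    refine BoundedContinuousFunction.arzela_ascoli (Metric.closedBall (0 : ℂ) ‖Φ‖)
      (isCompact_closedBall _ _) _ ?_ ?_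
    · rintro _ x ⟨_, ⟨f, hf, rfl⟩, rfl⟩
      rw [mem_closedBall_zero_iff] at hf ⊢
      calc ‖inner ℂ (Φ x) f‖ ≤ ‖Φ x‖ * ‖f‖ := norm_inner_le_norm _ _
        _ ≤ ‖Φ‖ * 1 := by gcongr; exact Φ.norm_coe_le_norm x
        _ = ‖Φ‖ := mul_one _
    · intro x
      rw [Metric.equicontinuousAt_iff_right]
      intro ε hε
      filter_upwards [Metric.continuousAt_iff'.1 Φ.continuous.continuousAt ε hε] with y hy
      rintro ⟨_, ⟨_, ⟨f, hf, rfl⟩, rfl⟩⟩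
      rw [mem_closedBall_zero_iff] at hf
      rw [dist_eq_norm'] at hy
      calc dist (inner ℂ (Φ x) f) (inner ℂ (Φ y) f) = ‖inner ℂ (Φ x - Φ y) f‖ := by
            rw [dist_eq_norm, inner_sub_left]
        _ ≤ ‖Φ x - Φ y‖ * ‖f‖ := norm_inner_le_norm _ _
        _ ≤ ‖Φ x - Φ y‖ * 1 := by gcongr
        _ < ε := by rwa [mul_one]
  have h := L.toHomeomorph.image_closure (innerOperator Φ '' Metric.closedBall 0 1)
  rw [← L.toHomeomorph.isCompact_image, h]
  exact key

end

variable [MeasurableSpace X] [BorelSpace X] (μ : Measure X) [IsFiniteMeasure μ]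

theorem integrable_of_continuous {E : Type*} [NormedAddCommGroup E] {f : X → E}
    (hf : Continuous f) : Integrable f μ :=
  hf.integrable_of_hasCompactSupport (HasCompactSupport.of_compactSpace f)

/-- The sections of a continuous kernel, as a continuous map to `L²`. -/
noncomputable def kernelSection (k : C(X × X, ℂ)) : C(X, Lp ℂ 2 μ) :=
  ⟨fun x => ContinuousMap.toLp 2 μ ℂ (k.curry x), by fun_prop⟩

theorem innerOperator_kernelSection_toLp (k : C(X × X, ℂ)) (h : C(X, ℂ)) (x : X) :
    innerOperator (kernelSection μ k) (ContinuousMap.toLp 2 μ ℂ h) x =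
      ∫ y, h y * star (k (x, y)) ∂μ :=
  ContinuousMap.inner_toLp μ (k.curry x) h

/-- The operator on `C(X)` with the continuous kernel `conj k`. -/
noncomputable def kernelOperator (k : C(X × X, ℂ)) : C(X, ℂ) →L[ℂ] C(X, ℂ) :=
  innerOperator (kernelSection μ k) ∘L ContinuousMap.toLp 2 μ ℂ

theorem kernelOperator_apply (k : C(X × X, ℂ)) (h : C(X, ℂ)) (x : X) :
    kernelOperator μ k h x = ∫ y, h y * star (k (x, y)) ∂μ :=
  innerOperator_kernelSection_toLp μ k h x

variable {μ}

/-- The kernel operator on `L²`. -/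
noncomputable def kernelOperatorL2 (μ : Measure X) [IsFiniteMeasure μ] (k : C(X × X, ℂ)) :
    Lp ℂ 2 μ →L[ℂ] Lp ℂ 2 μ :=
  ContinuousMap.toLp 2 μ ℂ ∘L innerOperator (kernelSection μ k)

theorem kernelOperatorL2_toLp (k : C(X × X, ℂ)) (h : C(X, ℂ)) :
    kernelOperatorL2 μ k (ContinuousMap.toLp 2 μ ℂ h) =
      ContinuousMap.toLp 2 μ ℂ (kernelOperator μ k h) := rfl

theorem isCompactOperator_kernelOperatorL2 (k : C(X × X, ℂ)) :
    IsCompactOperator (kernelOperatorL2 μ k) :=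
  (isCompactOperator_innerOperator _).clm_comp (ContinuousMap.toLp 2 μ ℂ)

theorem isSymmetric_kernelOperatorL2 [R1Space X] [μ.WeaklyRegular] {k : C(X × X, ℂ)}
    (hk : ∀ x y, k (y, x) = star (k (x, y))) :
    (kernelOperatorL2 μ k : Lp ℂ 2 μ →ₗ[ℂ] Lp ℂ 2 μ).IsSymmetric := by
  have hd := ContinuousMap.toLp_denseRange ℂ μ ℂ (p := 2) (by simp)
  intro f g
  refine hd.induction_on₂ (p := fun f g => inner ℂ (kernelOperatorL2 μ k f) g =
    inner ℂ f (kernelOperatorL2 μ k g)) (isClosed_eq (by fun_prop) (by fun_prop)) ?_ f g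
  intro f g
  rw [kernelOperatorL2_toLp, kernelOperatorL2_toLp, ContinuousMap.inner_toLp,
    ContinuousMap.inner_toLp]
  simp_rw [kernelOperator_apply, ← integral_conj, ← integral_const_mul, ← integral_mul_const]
  rw [integral_integral_swap_of_hasCompactSupport (by
    simp only [Function.uncurry_def]
    fun_prop) (HasCompactSupport.of_compactSpace _)]
  refine integral_congr_ae (.of_forall fun x => integral_congr_ae (.of_forall fun y => ?_))
  simp only [hk x y]
  simp
  ring

/-- The spectral theorem gives only `L²` approximation of `h` by eigenvectors. Applying the operator
once more, as a bounded map from `L²` to `C(X)`, makes it uniform: eigenvectors with nonzero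
eigenvalue become continuous eigenfunctions, and the null space is killed. -/
theorem kernelOperator_mem_closure_span_eigen [R1Space X] [μ.WeaklyRegular]
    [μ.IsOpenPosMeasure] {k : C(X × X, ℂ)} (hk : ∀ x y, k (y, x) = star (k (x, y)))
    (h : C(X, ℂ)) :
    kernelOperator μ k h ∈ closure (Submodule.span ℂ
      {w : C(X, ℂ) | ∃ c : ℂ, c ≠ 0 ∧ kernelOperator μ k w = c • w} : Set C(X, ℂ)) := by
  set S := Submodule.span ℂ {w : C(X, ℂ) | ∃ c : ℂ, c ≠ 0 ∧ kernelOperator μ k w = c • w}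
  let T := kernelOperatorL2 μ k
  have h1 := ContinuousLinearMap.orthogonalComplement_iSup_eigenspaces_eq_bot
    (isCompactOperator_kernelOperatorL2 k) (isSymmetric_kernelOperatorL2 (μ := μ) hk)
  rw [← Submodule.topologicalClosure_eq_top_iff] at h1
  have h2 : ∀ v ∈ ⨆ c, Module.End.eigenspace (T : Module.End ℂ (Lp ℂ 2 μ)) c,
      innerOperator (kernelSection μ k) v ∈ S := by
    intro v hv
    induction hv using Submodule.iSup_induction' with
    | mem c v hv =>
      have hv : ContinuousMap.toLp 2 μ ℂ (innerOperator (kernelSection μ k) v) = c • v :=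
        Module.End.mem_eigenspace_iff.1 hv
      by_cases hc : c = 0
      · rw [hc, zero_smul, ← map_zero (ContinuousMap.toLp 2 μ ℂ), ContinuousMap.toLp_inj] at hv
        rw [hv]
        exact zero_mem _
      · refine Submodule.subset_span ⟨c, hc, ?_⟩
        rw [kernelOperator, ContinuousLinearMap.comp_apply, hv, map_smul]
    | zero => simp
    | add v w _ _ hv hw => rw [map_add]; exact add_mem hv hw
  have h3 : ContinuousMap.toLp 2 μ ℂ h ∈ closure
      ((⨆ c, Module.End.eigenspace (T : Module.End ℂ (Lp ℂ 2 μ)) c : Submodule ℂ (Lp ℂ 2 μ)) :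
        Set (Lp ℂ 2 μ)) := by
    rw [← Submodule.topologicalClosure_coe, h1]
    trivial
  have h4 := map_mem_closure (t := (S : Set C(X, ℂ)))
    (innerOperator (kernelSection μ k)).continuous h3 h2
  exact h4

theorem finiteDimensional_kernelOperator_eigenspace [μ.IsOpenPosMeasure] (k : C(X × X, ℂ))
    {c : ℂ} (hc : c ≠ 0) :
    FiniteDimensional ℂ
      (Module.End.eigenspace (kernelOperator μ k : Module.End ℂ C(X, ℂ)) c) := by
  have := ContinuousLinearMap.finite_dimensional_eigenspace
    (isCompactOperator_kernelOperatorL2 (μ := μ) k) c hc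
  let f : C(X, ℂ) →ₗ[ℂ] Lp ℂ 2 μ := (ContinuousMap.toLp 2 μ ℂ : C(X, ℂ) →L[ℂ] Lp ℂ 2 μ)
  refine FiniteDimensional.of_injective (f.restrict
    (p := Module.End.eigenspace (kernelOperator μ k : Module.End ℂ C(X, ℂ)) c)
    (q := Module.End.eigenspace (kernelOperatorL2 μ k).toLinearMap c) ?_) ?_
  · intro w hw
    rw [Module.End.mem_eigenspace_iff] at hw ⊢
    have hw : kernelOperator μ k w = c • w := hw
    change ContinuousMap.toLp 2 μ ℂ (kernelOperator μ k w) = c • ContinuousMap.toLp 2 μ ℂ w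
    rw [hw, map_smul]
  · intro v w hvw
    exact Subtype.ext (ContinuousMap.toLp_injective μ (congrArg Subtype.val hvw))

end KernelOperator

/-! ### Mollifiers and orthonormal bases of continuous functions. -/

section

variable {X : Type*} [TopologicalSpace X] [CompactSpace X] [MeasurableSpace X] [BorelSpace X]
  (μ : Measure X) [IsFiniteMeasure μ]

theorem norm_integral_smul_sub_le {E : Type*} [NormedAddCommGroup E] [NormedSpace ℝ E]
    [CompleteSpace E] {φ : C(X, ℝ)} (hφ0 : ∀ x, 0 ≤ φ x)
    (hφ1 : ∫ x, φ x ∂μ = 1) {V : Set X} (hφV : ∀ x ∉ V, φ x = 0) {F : X → E} (hF : Continuous F)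
    {c : E}
    {ε : ℝ} (hFV : ∀ v ∈ V, ‖F v - c‖ ≤ ε) : ‖∫ v, φ v • F v ∂μ - c‖ ≤ ε := by
  have h1 : ∫ v, φ v • F v ∂μ - c = ∫ v, φ v • (F v - c) ∂μ := by
    simp_rw [smul_sub]
    rw [integral_sub (integrable_of_continuous μ (by fun_prop))
      (integrable_of_continuous μ (by fun_prop)), integral_smul_const, hφ1, one_smul]
  have h2 : ∫ v, φ v * ε ∂μ = ε := by rw [integral_mul_const, hφ1, one_mul]
  rw [h1, ← h2]
  refine norm_integral_le_of_norm_le (integrable_of_continuous μ (by fun_prop))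
    (.of_forall fun v => ?_)
  rw [norm_smul, Real.norm_of_nonneg (hφ0 v)]
  by_cases hv : v ∈ V
  · exact mul_le_mul_of_nonneg_left (hFV v hv) (hφ0 v)
  · simp [hφV v hv]

theorem exists_orthonormal_basis_of_finiteDimensional [μ.IsOpenPosMeasure]
    (W : Submodule ℂ C(X, ℂ))
    [FiniteDimensional ℂ W] :
    ∃ (n : ℕ) (e : Fin n → C(X, ℂ)), (∀ i, e i ∈ W) ∧
      (∀ i j, ∫ x, e j x * star (e i x) ∂μ = if i = j then 1 else 0) ∧
      ∀ w ∈ W, ∀ x, w x = ∑ i, (∫ y, w y * star (e i y) ∂μ) * e i x := by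
  let L : C(X, ℂ) →ₗ[ℂ] Lp ℂ 2 μ := (ContinuousMap.toLp 2 μ ℂ : C(X, ℂ) →L[ℂ] Lp ℂ 2 μ)
  have hL : Function.Injective L := ContinuousMap.toLp_injective μ
  have hinner (f g : C(X, ℂ)) : inner ℂ (L f) (L g) = ∫ x, g x * star (f x) ∂μ :=
    ContinuousMap.inner_toLp μ f g
  let b := stdOrthonormalBasis ℂ (W.map L)
  have hb (i) : ∃ e ∈ W, L e = b i := (b i).2
  choose e heW heb using hb
  refine ⟨_, e, heW, fun i j => ?_, fun w hw x => ?_⟩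
  · rw [← hinner, heb, heb, ← Submodule.coe_inner]
    exact orthonormal_iff_ite.1 b.orthonormal i j
  · have h := b.sum_repr' ⟨L w, w, hw, rfl⟩
    have h' := congrArg Subtype.val h
    simp only [Submodule.coe_sum, Submodule.coe_smul, Submodule.coe_inner, ← heb, hinner] at h'
    simp only [← map_smul, ← map_sum] at h'
    have h'' := DFunLike.congr_fun (hL h') x
    simpa [ContinuousMap.sum_apply] using h''.symm

end

/-! ### Translation-invariant spaces and approximate identities. -/

section PeterWeyl

variable {G : Type*} [Group G] [TopologicalSpace G]

theorem coeff_mem_trigPoly {n : ℕ} (π : G →* Matrix.unitaryGroup (Fin n) ℂ) (hπ : Continuous π)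
    (i j : Fin n) : (fun g => (π g : Matrix (Fin n) (Fin n) ℂ) i j) ∈ trigPoly G :=
  Submodule.subset_span ⟨n, π, hπ, i, j, rfl⟩

theorem star_coeff_mem_trigPoly {n : ℕ} (π : G →* Matrix.unitaryGroup (Fin n) ℂ)
    (hπ : Continuous π) (i j : Fin n) :
    (fun g => star ((π g : Matrix (Fin n) (Fin n) ℂ) i j)) ∈ trigPoly G := by
  have hstar (M : Matrix (Fin n) (Fin n) ℂ) :
      star ((starRingEnd ℂ).mapMatrix M) = (starRingEnd ℂ).mapMatrix (star M) := by
    ext; simp [Matrix.star_apply]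
  let σ : G →* Matrix.unitaryGroup (Fin n) ℂ :=
    { toFun := fun g => ⟨(starRingEnd ℂ).mapMatrix (π g : Matrix (Fin n) (Fin n) ℂ), by
        rw [Matrix.mem_unitaryGroup_iff, hstar, ← map_mul, Matrix.mem_unitaryGroup_iff.1 (π g).2,
          map_one]⟩
      map_one' := Subtype.ext (by simp)
      map_mul' := fun g h => Subtype.ext (by simp) }
  have hσ : Continuous σ := by
    refine Continuous.subtype_mk (continuous_matrix fun i j => ?_) _
    exact continuous_star.comp ((continuous_subtype_val.comp hπ).matrix_elem i j)
  exact coeff_mem_trigPoly σ hσ i j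

theorem continuous_of_mem_trigPoly {t : G → ℂ} (ht : t ∈ trigPoly G) : Continuous t := by
  induction ht using Submodule.span_induction with
  | mem t ht =>
    obtain ⟨n, π, hπ, i, j, rfl⟩ := ht
    exact (continuous_subtype_val.comp hπ).matrix_elem i j
  | zero => exact continuous_zero
  | add f g _ _ hf hg => exact hf.add hg
  | smul c f _ hf => exact hf.const_smul c

variable [IsTopologicalGroup G]

/-- Left translation of continuous functions. -/
noncomputable def leftTranslate (s : G) (h : C(G, ℂ)) : C(G, ℂ) :=
  ⟨fun x => h (s⁻¹ * x), by fun_prop⟩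

theorem leftTranslate_apply (s : G) (h : C(G, ℂ)) (x : G) :
    leftTranslate s h x = h (s⁻¹ * x) := rfl

variable [CompactSpace G] [MeasurableSpace G] [BorelSpace G]

/-- Left translation acts unitarily on `W`. In an orthonormal basis its matrix `P s` is a continuous
unitary representation, and evaluating `L_{s⁻¹} e_j` at `1` writes `e_j` through conjugates of its
coefficients. -/
theorem mem_trigPoly_of_leftTranslate_invariant (μ : Measure G) [IsFiniteMeasure μ]
    [μ.IsOpenPosMeasure] [μ.IsMulLeftInvariant] (W : Submodule ℂ C(G, ℂ))
    [FiniteDimensional ℂ W] (hW : ∀ s, ∀ w ∈ W, leftTranslate s w ∈ W) {w : C(G, ℂ)}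
    (hw : w ∈ W) : (w : G → ℂ) ∈ trigPoly G := by
  obtain ⟨n, e, heW, horth, hrepr⟩ := exists_orthonormal_basis_of_finiteDimensional μ W
  let P : G → Matrix (Fin n) (Fin n) ℂ :=
    fun s => Matrix.of fun i j => ∫ x, e j (s⁻¹ * x) * star (e i x) ∂μ
  have hPapply (s : G) (j : Fin n) (x : G) : e j (s⁻¹ * x) = ∑ i, P s i j * e i x :=
    hrepr _ (hW s _ (heW j)) x
  have hPone : P 1 = 1 := by
    ext i j
    simpa [P, Matrix.one_apply] using horth i j
  have hPmul (s t : G) : P (s * t) = P s * P t := by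
    ext i j
    have h1 (x : G) : e j ((s * t)⁻¹ * x) * star (e i x) =
        ∑ l, P t l j * (e l (s⁻¹ * x) * star (e i x)) := by
      rw [mul_inv_rev, mul_assoc, hPapply t j, Finset.sum_mul]
      exact Finset.sum_congr rfl fun l _ => mul_assoc _ _ _
    calc P (s * t) i j = ∫ x, ∑ l, P t l j * (e l (s⁻¹ * x) * star (e i x)) ∂μ :=
          integral_congr_ae (.of_forall h1)
      _ = ∑ l, P t l j * P s i l := by
          rw [integral_finsetSum _ fun l _ => integrable_of_continuous μ (by fun_prop)]
          exact Finset.sum_congr rfl fun l _ => integral_const_mul _ _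
      _ = (P s * P t) i j := by
          rw [Matrix.mul_apply]
          exact Finset.sum_congr rfl fun l _ => mul_comm _ _
  have hPstar (s : G) : star (P s) = P s⁻¹ := by
    ext i j
    calc star (∫ x, e i (s⁻¹ * x) * star (e j x) ∂μ)
        = ∫ x, star (e i (s⁻¹ * x) * star (e j x)) ∂μ := integral_conj.symm
      _ = ∫ x, e j x * star (e i (s⁻¹ * x)) ∂μ := by simp [mul_comm]
      _ = ∫ x, e j (s * x) * star (e i (s⁻¹ * (s * x))) ∂μ :=
          (integral_mul_left_eq_self (fun x => e j x * star (e i (s⁻¹ * x))) s).symm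
      _ = P s⁻¹ i j := by simp [P]
  have hPcont : Continuous P := by
    refine continuous_matrix fun i j => ?_
    let k : C(G × G, ℂ) := ⟨fun p => e j (p.1⁻¹ * p.2), by fun_prop⟩
    have h1 : (fun s => P s i j) = fun s =>
        inner ℂ (ContinuousMap.toLp 2 μ ℂ (e i)) (ContinuousMap.toLp 2 μ ℂ (k.curry s)) := by
      ext s
      rw [ContinuousMap.inner_toLp]
      rfl
    rw [h1]
    fun_prop
  let π : G →* Matrix.unitaryGroup (Fin n) ℂ :=
    { toFun := fun s => ⟨P s, by
        rw [Matrix.mem_unitaryGroup_iff, hPstar, ← hPmul, mul_inv_cancel, hPone]⟩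
      map_one' := Subtype.ext hPone
      map_mul' := fun s t => Subtype.ext (hPmul s t) }
  have hπ : Continuous π := hPcont.subtype_mk _
  have he (j : Fin n) : (e j : G → ℂ) ∈ trigPoly G := by
    have h1 : (e j : G → ℂ) =
        ∑ i, e i 1 • fun s => star ((π s : Matrix (Fin n) (Fin n) ℂ) j i) := by
      ext s
      have h2 := hPapply s⁻¹ j 1
      rw [inv_inv, mul_one] at h2
      rw [h2, Finset.sum_apply]
      refine Finset.sum_congr rfl fun i _ => ?_
      rw [← hPstar, Pi.smul_apply, smul_eq_mul, mul_comm]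
      rfl
    rw [h1]
    exact Submodule.sum_mem _ fun i _ =>
      Submodule.smul_mem _ _ (star_coeff_mem_trigPoly π hπ j i)
  have hw' : (w : G → ℂ) = ∑ i, (∫ y, w y * star (e i y) ∂μ) • (e i : G → ℂ) := by
    ext x
    simpa using hrepr w hw x
  rw [hw']
  exact Submodule.sum_mem _ fun i _ => Submodule.smul_mem _ _ (he i)

/-- The measure need only charge neighbourhoods of `1`, so that both Haar measure on `G` and that of
a closed subgroup qualify. Symmetry of `φ` makes the convolution kernel Hermitian. -/
theorem exists_symmetric_approx_identity [T2Space G] (ν : Measure G)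
    [IsFiniteMeasure ν]
    (hν : ∀ V ∈ 𝓝 (1 : G), ν V ≠ 0) {V : Set G} (hV : V ∈ 𝓝 (1 : G)) :
    ∃ φ : C(G, ℝ), (∀ x, 0 ≤ φ x) ∧ (∀ x ∉ V, φ x = 0) ∧ (∀ x, φ x⁻¹ = φ x) ∧
      ∫ x, φ x ∂ν = 1 := by
  have hV' : V ∩ V⁻¹ ∈ 𝓝 (1 : G) := Filter.inter_mem hV (inv_mem_nhds_one G hV)
  obtain ⟨ψ, hψ0, hψ1, hψ⟩ := exists_continuous_zero_one_of_isClosed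
    (isOpen_interior (s := V ∩ V⁻¹)).isClosed_compl (isClosed_singleton (x := (1 : G)))
    (by simpa using mem_interior_iff_mem_nhds.2 hV')
  let φ : C(G, ℝ) := ⟨fun x => ψ x + ψ x⁻¹, by fun_prop⟩
  have hφ0 (x : G) : 0 ≤ φ x := add_nonneg (hψ x).1 (hψ x⁻¹).1
  have hφV (x : G) (hx : x ∉ V) : φ x = 0 := by
    have h1 : ψ x = 0 := hψ0 fun h => hx (interior_subset h).1
    have h2 : ψ x⁻¹ = 0 := hψ0 fun h => hx (by simpa using (interior_subset h).2)
    simp [φ, h1, h2]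
  have hφs (x : G) : φ x⁻¹ = φ x := by simp [φ, add_comm]
  have hpos : 0 < ∫ x, φ x ∂ν := by
    rw [integral_pos_iff_support_of_nonneg hφ0 (integrable_of_continuous ν φ.continuous),
      pos_iff_ne_zero]
    refine hν _ (φ.continuous.isOpen_support.mem_nhds ?_)
    have h1 : ψ 1 = 1 := hψ1 rfl
    simp [φ, h1]
  refine ⟨(∫ x, φ x ∂ν)⁻¹ • φ, fun x => ?_, fun x hx => ?_, fun x => ?_, ?_⟩
  · exact mul_nonneg (inv_nonneg.2 hpos.le) (hφ0 x)
  · simp [hφV x hx]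
  · simp [hφs]
  · simp only [ContinuousMap.smul_apply, smul_eq_mul]
    rw [integral_const_mul, inv_mul_cancel₀ hpos.ne']

end PeterWeyl

/-! ### Uniform density of trigonometric polynomials. -/

section Density

variable {G : Type*} [Group G] [TopologicalSpace G] [IsTopologicalGroup G] [CompactSpace G]
  [T2Space G]

/-- The Peter–Weyl theorem: the trigonometric polynomials on a compact group are uniformly dense
in the continuous functions. -/
theorem exists_mem_trigPoly_norm_sub_lt (f : C(G, ℂ)) {ε : ℝ} (hε : 0 < ε) :
    ∃ t ∈ trigPoly G, ∀ x, ‖f x - t x‖ < ε := by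
  borelize G
  let μ : Measure G := Measure.haar
  let F : C(G, C(G, ℂ)) := ContinuousMap.curry ⟨fun p => f (p.2 * p.1), by fun_prop⟩
  have hF (v x : G) : F v x = f (x * v) := rfl
  have hV : {v | ‖F v - F 1‖ < ε / 2} ∈ 𝓝 (1 : G) :=
    (isOpen_lt (by fun_prop) continuous_const).mem_nhds (by simpa using half_pos hε)
  obtain ⟨φ, hφ0, hφV, hφs, hφ1⟩ := exists_symmetric_approx_identity μ
    (fun V hV => (Measure.measure_pos_of_mem_nhds μ hV).ne') hV
  let k : C(G × G, ℂ) := ⟨fun p => (φ (p.1⁻¹ * p.2) : ℂ), by fun_prop⟩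
  have hk (x y : G) : k (y, x) = star (k (x, y)) := by
    have h := hφs (x⁻¹ * y)
    rw [mul_inv_rev, inv_inv] at h
    simp [k, h]
  have h1 (x : G) : ‖kernelOperator μ k f x - f x‖ ≤ ε / 2 := by
    have h2 : kernelOperator μ k f x = ∫ v, φ v • f (x * v) ∂μ := by
      rw [kernelOperator_apply, ← integral_mul_left_eq_self _ x]
      simp [k, mul_comm]
    have h3 := norm_integral_smul_sub_le μ hφ0 hφ1 hφV (F := fun v => f (x * v)) (by fun_prop)
      (ε := ε / 2) fun v hv => ((F v - F 1).norm_coe_le_norm x).trans hv.le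
    rw [h2]
    simpa [hF] using h3
  have htrig : ∀ w ∈ Submodule.span ℂ
      {w : C(G, ℂ) | ∃ c : ℂ, c ≠ 0 ∧ kernelOperator μ k w = c • w},
      (w : G → ℂ) ∈ trigPoly G := by
    intro w hw
    induction hw using Submodule.span_induction with
    | mem w hw =>
      obtain ⟨c, hc, hw⟩ := hw
      have := finiteDimensional_kernelOperator_eigenspace (μ := μ) k hc
      refine mem_trigPoly_of_leftTranslate_invariant μ
        (Module.End.eigenspace (kernelOperator μ k : Module.End ℂ C(G, ℂ)) c) ?_
        (Module.End.mem_eigenspace_iff.2 hw)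
      -- Convolution with `φ` commutes with left translations, so its eigenspaces are translation
      -- invariant.
      intro s v hv
      rw [Module.End.mem_eigenspace_iff] at hv ⊢
      have hv : kernelOperator μ k v = c • v := hv
      ext x
      change kernelOperator μ k (leftTranslate s v) x = c • v (s⁻¹ * x)
      rw [← ContinuousMap.smul_apply, ← hv, kernelOperator_apply, kernelOperator_apply,
        ← integral_mul_left_eq_self _ s]
      simp [leftTranslate_apply, k, mul_assoc]
    | zero => exact zero_mem _
    | add v w _ _ hv hw => exact add_mem hv hw
    | smul c v _ hv => exact Submodule.smul_mem _ c hv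
  obtain ⟨t, ht, hdist⟩ := Metric.mem_closure_iff.1
    (kernelOperator_mem_closure_span_eigen (μ := μ) hk f) (ε / 2) (half_pos hε)
  refine ⟨t, htrig t ht, fun x => ?_⟩
  have h4 : ‖kernelOperator μ k f x - t x‖ < ε / 2 := by
    rw [dist_eq_norm] at hdist
    exact ((kernelOperator μ k f - t).norm_coe_le_norm x).trans_lt hdist
  calc ‖f x - t x‖ = ‖(kernelOperator μ k f x - t x) - (kernelOperator μ k f x - f x)‖ := by
        congr 1; ring
    _ ≤ ‖kernelOperator μ k f x - t x‖ + ‖kernelOperator μ k f x - f x‖ := norm_sub_le _ _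
    _ < ε := by linarith [h1 x]

end Density

/-! ### Continuity of evaluations. -/

section Evaluation

variable {X : Type*} [TopologicalSpace X]
variable {A : Type*} [NonUnitalNormedCommRing A] [NormedSpace ℂ A] [CompleteSpace A]

/-- Evaluations on a Banach function algebra are contractive. -/
theorem norm_apply_le (ι : A →ₙₐ[ℂ] C₀(X, ℂ)) (f : A) (x : X) : ‖ι f x‖ ≤ ‖f‖ := by
  by_contra! h
  have h0 : ι f x ≠ 0 := norm_pos_iff.1 ((norm_nonneg f).trans_lt h)
  set g : A := (ι f x)⁻¹ • f with hg
  have hg1 : ι g x = 1 := by simp [hg, h0]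
  have hgn : ‖g‖ < 1 := by
    rw [hg, norm_smul, norm_inv, inv_mul_lt_one₀ (norm_pos_iff.2 h0)]
    exact h
  -- A fixed point `a = g + g a`, evaluated at `x` where `g` is `1`, reads `a(x) = 1 + a(x)`, which
  -- is absurd. No unit of `A` is needed.
  have hc : ContractingWith ‖g‖₊ fun a => g + g * a := by
    refine ⟨hgn, LipschitzWith.of_dist_le_mul fun a b => ?_⟩
    rw [dist_add_left, dist_eq_norm, dist_eq_norm, ← mul_sub]
    exact norm_mul_le _ _
  have hfix : g + g * hc.fixedPoint = hc.fixedPoint := hc.fixedPoint_isFixedPt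
  have := congrArg (fun a => ι a x) hfix
  simp [hg1] at this

/-- Evaluation at a point of a Banach function algebra, as a continuous functional. -/
noncomputable def evalCLM (ι : A →ₙₐ[ℂ] C₀(X, ℂ)) (x : X) : A →L[ℂ] ℂ :=
  LinearMap.mkContinuous
    { toFun := fun f => ι f x
      map_add' := fun f g => by simp
      map_smul' := fun c f => by simp } 1 (fun f => by simpa using norm_apply_le ι f x)

theorem evalCLM_apply (ι : A →ₙₐ[ℂ] C₀(X, ℂ)) (x : X) (f : A) : evalCLM ι x f = ι f x := rfl

end Evaluation

/-! ### Averages of right translates. -/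

section Average

variable {G : Type*} [Group G] [TopologicalSpace G]
variable {A : Type*} [NonUnitalNormedCommRing A] [NormedSpace ℂ A] {ι : A →ₙₐ[ℂ] C₀(G, ℂ)}

/-- The right translation `s ↦ R_s f`. -/
noncomputable def rightTranslate (htrans : HasContinuousIsometricRightTranslations ι) (f : A) :
    G → A := (htrans f).choose

variable (htrans : HasContinuousIsometricRightTranslations ι)

theorem apply_rightTranslate (f : A) (s x : G) : ι (rightTranslate htrans f s) x = ι f (x * s) :=
  (htrans f).choose_spec.1 s x

theorem norm_rightTranslate (f : A) (s : G) : ‖rightTranslate htrans f s‖ = ‖f‖ :=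
  (htrans f).choose_spec.2.1 s

@[fun_prop]
theorem continuous_rightTranslate (f : A) : Continuous (rightTranslate htrans f) :=
  (htrans f).choose_spec.2.2

theorem rightTranslate_one (hι : Function.Injective ι) (f : A) :
    rightTranslate htrans f 1 = f :=
  hι (by ext x; simp [apply_rightTranslate])

variable [CompactSpace G] [MeasurableSpace G] [BorelSpace G] (ν : Measure G)
  [IsProbabilityMeasure ν]

/-- The average `∫ φ(k) R_k f dν(k)` of the right translates of `f`. -/
noncomputable def average (φ : G → ℂ) (f : A) : A := ∫ k, φ k • rightTranslate htrans f k ∂ν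

theorem apply_average [CompleteSpace A] {φ : G → ℂ} (hφ : Continuous φ)
    (f : A) (x : G) :
    ι (average htrans ν φ f) x = ∫ k, φ k * ι f (x * k) ∂ν := by
  rw [← evalCLM_apply, average, ← ContinuousLinearMap.integral_comp_comm _
    (integrable_of_continuous ν (by fun_prop))]
  simp [evalCLM_apply, apply_rightTranslate]

theorem norm_average_sub_le {φ ψ : G → ℂ} (hφ : Continuous φ) (hψ : Continuous ψ) {ε : ℝ}
    (h : ∀ x, ‖φ x - ψ x‖ ≤ ε) (f : A) :
    ‖average htrans ν φ f - average htrans ν ψ f‖ ≤ ε * ‖f‖ := by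
  rw [average, average, ← integral_sub (integrable_of_continuous ν (by fun_prop))
    (integrable_of_continuous ν (by fun_prop))]
  refine (norm_integral_le_of_norm_le_const (C := ε * ‖f‖) (.of_forall fun k => ?_)).trans
    (by simp)
  rw [← sub_smul, norm_smul, norm_rightTranslate]
  exact mul_le_mul_of_nonneg_right (h k) (norm_nonneg f)

theorem norm_average_one_sub_le (hι : Function.Injective ι) (f g : A) :
    ‖average htrans ν 1 f - average htrans ν 1 g‖ ≤ ‖f - g‖ := by
  have hsub (k : G) : rightTranslate htrans f k - rightTranslate htrans g k =
      rightTranslate htrans (f - g) k :=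
    hι (by ext x; simp [apply_rightTranslate])
  rw [average, average, ← integral_sub (integrable_of_continuous ν (by fun_prop))
    (integrable_of_continuous ν (by fun_prop))]
  refine (norm_integral_le_of_norm_le_const (C := ‖f - g‖) (.of_forall fun k => ?_)).trans
    (by simp)
  simp [hsub, norm_rightTranslate]

/-- A mollifier `φ` concentrated near `1` barely moves `f`, by norm continuity of translation;
replacing `φ` by a uniformly close trigonometric polynomial costs at most the uniform error times
`‖f‖`. -/
theorem exists_norm_average_sub_lt [IsTopologicalGroup G] [T2Space G] [CompleteSpace A]
    (hι : Function.Injective ι) (hν : ∀ V ∈ 𝓝 (1 : G), ν V ≠ 0) (f : A) {ε : ℝ} (hε : 0 < ε) :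
    ∃ t ∈ trigPoly G, ‖average htrans ν t f - f‖ < ε := by
  have hV : {v | ‖rightTranslate htrans f v - f‖ < ε / 2} ∈ 𝓝 (1 : G) :=
    (isOpen_lt (by fun_prop) continuous_const).mem_nhds
      (by simpa [rightTranslate_one htrans hι] using half_pos hε)
  obtain ⟨φ, hφ0, hφV, -, hφ1⟩ := exists_symmetric_approx_identity ν hν hV
  have h1 : ‖average htrans ν (fun k => (φ k : ℂ)) f - f‖ ≤ ε / 2 := by
    have := norm_integral_smul_sub_le ν hφ0 hφ1 hφV (continuous_rightTranslate htrans f)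
      (c := f) (ε := ε / 2) fun v hv => hv.le
    simpa [average] using this
  have hδ : 0 < ε / (2 * (‖f‖ + 1)) := by positivity
  obtain ⟨t, ht, htφ⟩ := exists_mem_trigPoly_norm_sub_lt
    (⟨fun k => (φ k : ℂ), by fun_prop⟩ : C(G, ℂ)) hδ
  refine ⟨t, ht, ?_⟩
  have h2 := norm_average_sub_le htrans ν (φ := t) (ψ := fun k => (φ k : ℂ))
    (continuous_of_mem_trigPoly ht) (by fun_prop) (fun x => by
      rw [norm_sub_rev]; exact (htφ x).le) f
  have h3 : ε / (2 * (‖f‖ + 1)) * ‖f‖ < ε / 2 := by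
    have : 0 ≤ ‖f‖ := norm_nonneg f
    rw [div_mul_eq_mul_div, div_lt_div_iff₀ (by positivity) two_pos]
    nlinarith
  calc ‖average htrans ν t f - f‖ ≤ _ := norm_sub_le_norm_sub_add_norm_sub _ _ _
    _ < ε := by linarith

end Average

/-! ### Normality of the algebra. -/

section Normality

variable {G : Type*} [Group G] [TopologicalSpace G] [IsTopologicalGroup G] [CompactSpace G]
  [T2Space G]
variable {A : Type*} [NonUnitalNormedCommRing A] [NormedSpace ℂ A] {ι : A →ₙₐ[ℂ] C₀(G, ℂ)}

theorem exists_integral_eq_one_of_isOpen [MeasurableSpace G] [BorelSpace G] (μ : Measure G)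
    [IsProbabilityMeasure μ] [μ.IsOpenPosMeasure] (hreg : IsRegularOn ι)
    (htrig : IsTrigPolyModule ι) {U : Set G} (hU : IsOpen U) {x : G} (hx : x ∈ U) :
    ∃ f : A, (∀ y ∉ U, ι f y = 0) ∧ ∫ y, ι f y ∂μ = 1 := by
  obtain ⟨f, hfU, hfx⟩ := hreg Uᶜ hU.isClosed_compl x (not_not.2 hx)
  have key : ∃ t ∈ trigPoly G, ∫ y, t y * ι f y ∂μ ≠ 0 := by
    -- If `f` were orthogonal to all trigonometric polynomials, letting `t` approach the conjugate
    -- of `f` would give `∫ |f|² = 0`.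
    by_contra! hzero
    have hpos : 0 < ∫ y, ‖ι f y‖ ^ 2 ∂μ := by
      rw [integral_pos_iff_support_of_nonneg (fun y => by positivity)
        (integrable_of_continuous μ (by fun_prop))]
      refine IsOpen.measure_pos μ ?_ ⟨x, by simpa using hfx⟩
      exact Continuous.isOpen_support (by fun_prop)
    set I := ∫ y, ‖ι f y‖ ^ 2 ∂μ
    obtain ⟨t, ht, htf⟩ := exists_mem_trigPoly_norm_sub_lt
      (⟨fun y => star (ι f y), by fun_prop⟩ : C(G, ℂ)) (ε := I / (‖ι f‖ + 1)) (by positivity)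
    have htc := continuous_of_mem_trigPoly ht
    have h1 : (I : ℂ) = ∫ y, (star (ι f y) - t y) * ι f y ∂μ := by
      simp_rw [sub_mul]
      rw [integral_sub (integrable_of_continuous μ (by fun_prop))
        (integrable_of_continuous μ (by fun_prop)), hzero t ht, sub_zero, ← integral_complex_ofReal]
      simp [Complex.conj_mul']
    have h2 : ‖(I : ℂ)‖ ≤ I / (‖ι f‖ + 1) * ‖ι f‖ := by
      rw [h1]
      refine (norm_integral_le_of_norm_le_const (C := I / (‖ι f‖ + 1) * ‖ι f‖)
        (.of_forall fun y => ?_)).trans (by simp)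
      rw [norm_mul]
      gcongr
      · exact (htf y).le
      · exact (ι f).toBCF.norm_coe_le_norm y
    rw [Complex.norm_real, Real.norm_of_nonneg hpos.le, div_mul_eq_mul_div,
      le_div_iff₀ (by positivity)] at h2
    nlinarith
  obtain ⟨t, ht, hne⟩ := key
  obtain ⟨g, hg⟩ := htrig t ht f
  refine ⟨(∫ y, t y * ι f y ∂μ)⁻¹ • g, fun y hy => by simp [hg, hfU y hy], ?_⟩
  simp only [map_smul, ZeroAtInftyContinuousMap.smul_apply, smul_eq_mul, hg]
  rw [integral_const_mul, inv_mul_cancel₀ hne]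

variable [CompleteSpace A]

/-- A translation invariant regular Banach function algebra on a compact group that is a module
over the trigonometric polynomials is normal. -/
theorem exists_eqOn_one_eqOn_zero (hreg : IsRegularOn ι)
    (htrans : HasContinuousIsometricRightTranslations ι) (htrig : IsTrigPolyModule ι)
    {C D : Set G} (hC : IsClosed C) (hD : IsClosed D) (hCD : Disjoint C D) :
    ∃ u : A, (∀ x ∈ C, ι u x = 1) ∧ ∀ x ∈ D, ι u x = 0 := by
  borelize G
  let μ : Measure G := Measure.haarMeasure ⊤
  have hμ : IsProbabilityMeasure μ :=
    ⟨by simpa using Measure.haarMeasure_self (K₀ := (⊤ : TopologicalSpace.PositiveCompacts G))⟩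
  -- The function sought is `u(x) = ∫ φ(x⁻¹k) f(k) dk`, with `f` of integral one supported near `1`;
  -- hence `φ` must be `1` near `C⁻¹` and `0` near `D⁻¹`. Positivity of `f` plays no role.
  obtain ⟨V, W, hV, hW, hCV, hDW, hVW⟩ :=
    normal_separation hC.inv hD.inv (hCD.preimage _)
  obtain ⟨V', hV', hCV', hVV'⟩ := normal_exists_closure_subset hC.inv hV hCV
  obtain ⟨φ, hφ0, hφ1, -⟩ := exists_continuous_zero_one_of_isClosed hV.isClosed_compl
    (isClosed_closure (s := V')) (Set.disjoint_compl_left_iff_subset.2 hVV')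
  obtain ⟨N, hN, hCN⟩ := compact_open_separated_mul_right hC.inv.isCompact hV' hCV'
  obtain ⟨M, hM, hDM⟩ := compact_open_separated_mul_right hD.inv.isCompact hW hDW
  obtain ⟨f, hfU, hf1⟩ := exists_integral_eq_one_of_isOpen μ hreg htrig
    (isOpen_interior (s := N ∩ M)) (mem_interior_iff_mem_nhds.2 (Filter.inter_mem hN hM))
  have happ (x : G) : ι (average htrans μ (fun k => (φ k : ℂ)) f) x =
      ∫ k, φ (x⁻¹ * k) * ι f k ∂μ := by
    rw [apply_average htrans μ (by fun_prop), ← integral_mul_left_eq_self _ x⁻¹]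
    simp
  refine ⟨average htrans μ (fun k => (φ k : ℂ)) f, fun x hx => ?_, fun x hx => ?_⟩
  · rw [happ, ← hf1]
    refine integral_congr_ae (.of_forall fun k => ?_)
    by_cases hk : k ∈ interior (N ∩ M)
    · have h1 : φ (x⁻¹ * k) = 1 := hφ1 (subset_closure (hCN
        (Set.mul_mem_mul (Set.inv_mem_inv.2 hx) (interior_subset hk).1)))
      simp [h1]
    · simp [hfU k hk]
  · rw [happ, ← integral_zero G ℂ (μ := μ)]
    refine integral_congr_ae (.of_forall fun k => ?_)
    by_cases hk : k ∈ interior (N ∩ M)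
    · have h1 : φ (x⁻¹ * k) = 0 := hφ0 fun h => hVW.le_bot ⟨h, hDM
        (Set.mul_mem_mul (Set.inv_mem_inv.2 hx) (interior_subset hk).2)⟩
      simp [h1]
    · simp [hfU k hk]

theorem exists_apply_eq_of_mem_trigPoly (hreg : IsRegularOn ι)
    (htrans : HasContinuousIsometricRightTranslations ι) (htrig : IsTrigPolyModule ι)
    {t : G → ℂ} (ht : t ∈ trigPoly G) : ∃ a : A, ∀ x, ι a x = t x := by
  -- Normality for the pair `G`, `∅` puts the constant function `1` in `A`.
  obtain ⟨u, hu, -⟩ := exists_eqOn_one_eqOn_zero hreg htrans htrig isClosed_univ isClosed_empty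
    (Set.disjoint_empty _)
  obtain ⟨a, ha⟩ := htrig t ht u
  exact ⟨a, fun x => by rw [ha, hu x trivial, mul_one]⟩

end Normality

/-! ### Reduction of weak synthesis to one inclusion. -/

section FunctionAlgebra

variable {X : Type*} [TopologicalSpace X]
variable {A : Type*} [NonUnitalNormedCommRing A] [NormedSpace ℂ A] {ι : A →ₙₐ[ℂ] C₀(X, ℂ)}
  {E : Set X}

theorem mem_vanishingNear_iff [CompactSpace X] {f : A} :
    f ∈ vanishingNear ι E ↔ ∀ x ∈ E, ∀ᶠ y in 𝓝 x, ι f y = 0 := by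
  have h : HasCompactSupport (ι f) := HasCompactSupport.of_compactSpace _
  simp only [vanishingNear, Set.mem_ofPred_eq, h, and_true, Set.disjoint_right,
    notMem_tsupport_iff_eventuallyEq]
  rfl

theorem vanishingNear_subset_vanishing : vanishingNear ι E ⊆ vanishing ι E :=
  fun _ hf _ hx => image_eq_zero_of_notMem_tsupport fun h => hf.1.le_bot ⟨h, hx⟩

/-- On a compact space only closedness of `I(E)` is at stake. Assuming continuous evaluations,
rather than completeness, lets this apply directly to `A(G:K)`. -/
theorem localVanishing_eq_vanishing [CompactSpace X] (hcont : ∀ x, Continuous fun f => ι f x) :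
    localVanishing ι E = vanishing ι E := by
  have hclosed : IsClosed (vanishing ι E) := by
    have : vanishing ι E = ⋂ x ∈ E, {f | ι f x = 0} := by ext; simp [vanishing]
    rw [this]
    exact isClosed_biInter fun x _ => isClosed_eq (hcont x) continuous_const
  have h (f : A) : HasCompactSupport (ι f) := HasCompactSupport.of_compactSpace _
  simp [localVanishing, h]

theorem isLocalWeakSynthesis_iff_isWeakSynthesis [CompactSpace X] [CompleteSpace A] (d : ℕ)
    (F : Set X) :
    IsLocalWeakSynthesis ι F d ↔ IsWeakSynthesis ι F d := by
  rw [IsLocalWeakSynthesis, localVanishing_eq_vanishing fun x => (evalCLM ι x).continuous]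
  rfl

/-- A function `u` in `I(E)` equal to `1` on the support of `f` satisfies `f u = f`, so `f = f u ⋯
u` with any number of factors. -/
theorem isProductOf_of_mem_vanishingNear (hι : Function.Injective ι)
    (hnormal : ∀ C, IsClosed C → Disjoint C E → ∃ u ∈ vanishing ι E, ∀ x ∈ C, ι u x = 1)
    {f : A} (hf : f ∈ vanishingNear ι E) {d : ℕ} (hd : 0 < d) :
    IsProductOf (vanishing ι E) d f := by
  obtain ⟨u, huE, hu⟩ := hnormal _ (isClosed_tsupport (ι f)) hf.1
  have hfu : f * u = f := by
    refine hι ?_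
    ext x
    by_cases hx : x ∈ tsupport (ι f)
    · simp [hu x hx]
    · simp [image_eq_zero_of_notMem_tsupport hx]
  induction d, hd using Nat.le_induction with
  | base => exact .one f (vanishingNear_subset_vanishing hf)
  | succ d _ ih => exact hfu ▸ IsProductOf.mul d f u ih huE

theorem isWeakSynthesis_iff_closedPower_subset (hι : Function.Injective ι)
    (hnormal : ∀ C, IsClosed C → Disjoint C E → ∃ u ∈ vanishing ι E, ∀ x ∈ C, ι u x = 1)
    {d : ℕ} (hd : 0 < d) :
    IsWeakSynthesis ι E d ↔ closedPower (vanishing ι E) d ⊆ closure (vanishingNear ι E) := by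
  refine ⟨fun h => h.subset, fun h => h.antisymm (closure_mono fun f hf => ?_)⟩
  exact Submodule.subset_span (isProductOf_of_mem_vanishingNear hι hnormal hf hd)

/-- `I₀(E)` as a subspace. -/
def vanishingNearSubmodule [CompactSpace X] (ι : A →ₙₐ[ℂ] C₀(X, ℂ)) (E : Set X) :
    Submodule ℂ A where
  carrier := vanishingNear ι E
  add_mem' {f g} hf hg := by
    rw [mem_vanishingNear_iff] at hf hg ⊢
    intro x hx
    filter_upwards [hf x hx, hg x hx] with y hfy hgy
    simp [hfy, hgy]
  zero_mem' := by
    rw [mem_vanishingNear_iff]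
    exact fun x _ => .of_forall fun y => by simp
  smul_mem' c f hf := by
    rw [mem_vanishingNear_iff] at hf ⊢
    intro x hx
    filter_upwards [hf x hx] with y hy
    simp [hy]

theorem mul_mem_closure_vanishingNear [CompactSpace X] (a : A) {f : A}
    (hf : f ∈ closure (vanishingNear ι E)) : a * f ∈ closure (vanishingNear ι E) := by
  refine map_mem_closure (continuous_const_mul a) hf fun g hg => ?_
  rw [mem_vanishingNear_iff] at hg ⊢
  intro x hx
  filter_upwards [hg x hx] with y hy
  simp [hy]

end FunctionAlgebra

/-! ### Powers of a closed ideal given by generators. -/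

section GeneratedPowers

variable {A : Type*} [NonUnitalNormedCommRing A] [NormedSpace ℂ A] [IsScalarTower ℂ A A]
  [SMulCommClass ℂ A A]

/-- The closed linear span of the multiples of products of `d` elements of `S`. -/
def multiplesOfProducts (S : Set A) (d : ℕ) : Submodule ℂ A :=
  (Submodule.span ℂ {c : A | ∃ a b, IsProductOf S d b ∧ c = a * b}).topologicalClosure

theorem mul_mem_multiplesOfProducts {S : Set A} {d : ℕ} {f g : A}
    (hf : f ∈ multiplesOfProducts S d) (hg : g ∈ multiplesOfProducts S 1) :
    f * g ∈ multiplesOfProducts S (d + 1) := by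
  refine map_mem_closure₂ continuous_mul hf hg fun f hf g hg => ?_
  refine Submodule.span_induction₂ (p := fun f g _ _ => f * g ∈ Submodule.span ℂ
    {c : A | ∃ a b, IsProductOf S (d + 1) b ∧ c = a * b}) ?_ ?_ ?_ ?_ ?_ ?_ ?_ hf hg
  · rintro _ _ ⟨a, b, hb, rfl⟩ ⟨a', b', hb', rfl⟩
    -- Products start at one factor, so the second constructor would need an impossible product of
    -- zero factors.
    have hb'S : b' ∈ S := by
      cases hb' with
      | one _ h => exact h
      | mul d _ _ h => cases h
    exact Submodule.subset_span ⟨a * a', b * b', .mul d b b' hb hb'S, mul_mul_mul_comm _ _ _ _⟩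
  · intro g _; simp
  · intro f _; simp
  · intro f f' g _ _ _ h h'; rw [add_mul]; exact add_mem h h'
  · intro f g g' _ _ _ h h'; rw [mul_add]; exact add_mem h h'
  · intro c f g _ _ h; rw [smul_mul_assoc]; exact Submodule.smul_mem _ c h
  · intro c f g _ _ h; rw [mul_smul_comm]; exact Submodule.smul_mem _ c h

theorem closedPower_subset_multiplesOfProducts {S T : Set A}
    (h : T ⊆ (multiplesOfProducts S 1 : Set A)) (d : ℕ) :
    closedPower T d ⊆ (multiplesOfProducts S d : Set A) := by
  have hprod {d : ℕ} {f : A} (hf : IsProductOf T d f) : f ∈ multiplesOfProducts S d := by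
    induction hf with
    | one f hf => exact h hf
    | mul d f g _ hg ih => exact mul_mem_multiplesOfProducts ih (h hg)
  exact closure_minimal (Submodule.span_le.2 fun f hf => hprod hf)
    (Submodule.isClosed_topologicalClosure _)

end GeneratedPowers

/-! ### Haar measure of a closed subgroup. -/

section Subgroup

variable {G : Type*} [Group G] [TopologicalSpace G] [IsTopologicalGroup G] [CompactSpace G]

/-- Normalized Haar measure on a closed subgroup, as a measure on the whole group. -/
theorem exists_measure_of_isClosed_subgroup [MeasurableSpace G] [BorelSpace G] {K : Subgroup G}
    (hK : IsClosed (K : Set G)) :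
    ∃ ν : Measure G, IsProbabilityMeasure ν ∧ (∀ V ∈ 𝓝 (1 : G), ν V ≠ 0) ∧ (∀ᵐ k ∂ν, k ∈ K) ∧
      ∀ k ∈ K, ∀ F : G → ℂ, Continuous F → ∫ x, F (k * x) ∂ν = ∫ x, F x ∂ν := by
  have : CompactSpace K := isCompact_iff_compactSpace.1 hK.isCompact
  let μ : Measure K := Measure.haarMeasure ⊤
  have hμ : IsProbabilityMeasure μ :=
    ⟨by simpa using Measure.haarMeasure_self (K₀ := (⊤ : TopologicalSpace.PositiveCompacts K))⟩
  have hmeas : Measurable (Subtype.val : K → G) := continuous_subtype_val.measurable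
  refine ⟨μ.map Subtype.val, Measure.isProbabilityMeasure_map hmeas.aemeasurable, ?_, ?_, ?_⟩
  · intro V hV h0
    have h1 : μ (Subtype.val ⁻¹' V) = 0 :=
      le_antisymm ((Measure.le_map_apply hmeas.aemeasurable V).trans h0.le) zero_le
    exact (Measure.measure_pos_of_mem_nhds μ
      (continuous_subtype_val.continuousAt.preimage_mem_nhds (x := (1 : K)) hV)).ne' h1
  · exact (ae_map_iff hmeas.aemeasurable hK.measurableSet).2 (.of_forall fun k => k.2)
  · intro k hk F hF
    have hint (F : G → ℂ) (hF : Continuous F) :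
        ∫ x, F x ∂(μ.map Subtype.val) = ∫ x : K, F x ∂μ :=
      (MeasurableEmbedding.subtype_coe hK.measurableSet).integral_map F
    rw [hint _ (by fun_prop), hint F hF]
    exact integral_mul_left_eq_self (fun x : K => F x) (⟨k, hk⟩ : K)

end Subgroup

/-! ### Passage between `G` and `G/K`. -/

section Quotient

variable {G : Type*} [Group G] [TopologicalSpace G]
variable {A : Type*} [NonUnitalNormedCommRing A] [NormedSpace ℂ A] {ι : A →ₙₐ[ℂ] C₀(G, ℂ)}
  {K : Subgroup G} {E : Set (G ⧸ K)}

theorem exists_isProductOf_cosetMap {S : Set (rightInvariant ι K)} {d : ℕ} {b : A}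
    (hb : IsProductOf ((↑) '' S : Set A) d b) :
    ∃ b' : rightInvariant ι K, IsProductOf S d b' ∧ (b' : A) = b := by
  induction hb with
  | one b hb =>
    obtain ⟨b', hb', rfl⟩ := hb
    exact ⟨b', .one _ hb', rfl⟩
  | mul d b c _ hc ih =>
    obtain ⟨b', hb', rfl⟩ := ih
    obtain ⟨c', hc', rfl⟩ := hc
    exact ⟨b' * c', .mul d _ _ hb' hc', rfl⟩

section

variable [CompactSpace G]

theorem cosetMap_injective (hι : Function.Injective ι) :
    Function.Injective (cosetMap ι K) := by
  intro f g h
  refine Subtype.ext (hι ?_)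
  ext s
  exact DFunLike.congr_fun h (s : G ⧸ K)

theorem mem_vanishing_cosetMap {f : rightInvariant ι K} :
    f ∈ vanishing (cosetMap ι K) E ↔ (f : A) ∈ vanishing ι {s : G | (s : G ⧸ K) ∈ E} :=
  ⟨fun h s hs => h s hs, fun h x hx => by
    induction x using QuotientGroup.induction_on with | H s => exact h s hx⟩

/-- The quotient map is open and continuous, so it carries neighbourhood filters to neighbourhood
filters. -/
theorem mem_vanishingNear_cosetMap [IsTopologicalGroup G] {f : rightInvariant ι K} :
    f ∈ vanishingNear (cosetMap ι K) E ↔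
      (f : A) ∈ vanishingNear ι {s : G | (s : G ⧸ K) ∈ E} := by
  have key (s : G) : (∀ᶠ y in 𝓝 (s : G ⧸ K), cosetMap ι K f y = 0) ↔
      ∀ᶠ x in 𝓝 s, ι (f : A) x = 0 := by
    rw [← QuotientGroup.isOpenQuotientMap_mk.map_nhds_eq s, Filter.eventually_map]
    rfl
  rw [mem_vanishingNear_iff, mem_vanishingNear_iff]
  refine ⟨fun h s hs => (key s).1 (h s hs), fun h x hx => ?_⟩
  induction x using QuotientGroup.induction_on with | H s => exact (key s).2 (h s hx)

theorem coe_mem_closedPower_vanishing {d : ℕ} {f : rightInvariant ι K}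
    (hf : f ∈ closedPower (vanishing (cosetMap ι K) E) d) :
    (f : A) ∈ closedPower (vanishing ι {s : G | (s : G ⧸ K) ∈ E}) d := by
  have hprod {d : ℕ} {g : rightInvariant ι K}
      (hg : IsProductOf (vanishing (cosetMap ι K) E) d g) :
      IsProductOf (vanishing ι {s : G | (s : G ⧸ K) ∈ E}) d (g : A) := by
    induction hg with
    | one g hg => exact .one _ (mem_vanishing_cosetMap.1 hg)
    | mul d g h _ hh ih => exact .mul d _ _ ih (mem_vanishing_cosetMap.1 hh)
  refine map_mem_closure continuous_subtype_val hf fun g hg => ?_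
  induction hg using Submodule.span_induction with
  | mem g hg => exact Submodule.subset_span (hprod hg)
  | zero => exact zero_mem _
  | add g h _ _ hg hh => exact add_mem hg hh
  | smul c g _ hg => exact Submodule.smul_mem _ c hg

theorem isLocalWeakSynthesis_cosetMap_iff_isWeakSynthesis [CompleteSpace A] (d : ℕ) :
    IsLocalWeakSynthesis (cosetMap ι K) E d ↔ IsWeakSynthesis (cosetMap ι K) E d := by
  rw [IsLocalWeakSynthesis, localVanishing_eq_vanishing]
  · rfl
  · intro x
    induction x using QuotientGroup.induction_on with
    | H s => exact (evalCLM ι s).continuous.comp continuous_subtype_val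

end

section Projection

variable [CompactSpace G] [MeasurableSpace G] [BorelSpace G]
  [CompleteSpace A] (htrans : HasContinuousIsometricRightTranslations ι)
  {ν : Measure G} [IsProbabilityMeasure ν]

theorem apply_average_one (f : A) (x : G) :
    ι (average htrans ν 1 f) x = ∫ k, ι f (x * k) ∂ν := by
  simpa using apply_average htrans ν (φ := 1) continuous_const f x

theorem average_one_mem_rightInvariant [IsTopologicalGroup G]
    (hνinv : ∀ k ∈ K, ∀ F : G → ℂ, Continuous F → ∫ x, F (k * x) ∂ν = ∫ x, F x ∂ν) (f : A) :
    average htrans ν 1 f ∈ rightInvariant ι K := by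
  intro k hk x
  rw [apply_average_one, apply_average_one, ← hνinv k hk (fun y => ι f (x * y)) (by fun_prop)]
  simp_rw [mul_assoc]

theorem apply_average_one_eq (hνK : ∀ᵐ k ∂ν, k ∈ K) {f : A} {x : G} {c : ℂ}
    (h : ∀ k ∈ K, ι f (x * k) = c) : ι (average htrans ν 1 f) x = c := by
  rw [apply_average_one, integral_congr_ae (hνK.mono h)]
  simp

theorem average_one_eq_self (hι : Function.Injective ι) (hνK : ∀ᵐ k ∂ν, k ∈ K) {f : A}
    (hf : f ∈ rightInvariant ι K) : average htrans ν 1 f = f := by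
  refine hι ?_
  ext x
  exact apply_average_one_eq htrans hνK fun k hk => hf k hk x

theorem average_one_mem_vanishing (hνK : ∀ᵐ k ∂ν, k ∈ K) {f : A}
    (hf : f ∈ vanishing ι {s : G | (s : G ⧸ K) ∈ E}) :
    average htrans ν 1 f ∈ vanishing ι {s : G | (s : G ⧸ K) ∈ E} := by
  intro x hx
  refine apply_average_one_eq htrans hνK fun k hk => hf _ ?_
  rwa [Set.mem_ofPred_eq, QuotientGroup.mk_mul_of_mem x hk]

theorem average_one_mem_vanishingNear [IsTopologicalGroup G] (hK : IsClosed (K : Set G))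
    (hνK : ∀ᵐ k ∂ν, k ∈ K) {f : A} (hf : f ∈ vanishingNear ι {s : G | (s : G ⧸ K) ∈ E}) :
    average htrans ν 1 f ∈ vanishingNear ι {s : G | (s : G ⧸ K) ∈ E} := by
  rw [mem_vanishingNear_iff]
  intro x hx
  have hxK : (x * ·) '' (K : Set G) ⊆ (tsupport (ι f))ᶜ := by
    rintro _ ⟨k, hk, rfl⟩ h
    refine hf.1.le_bot ⟨h, ?_⟩
    rwa [Set.mem_ofPred_eq, QuotientGroup.mk_mul_of_mem x hk]
  -- The compact coset `xK` misses the support of `f`; a uniform neighbourhood `V` of `1` makes `yK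
  -- = (y x⁻¹) xK` miss it too for all `y` near `x`.
  obtain ⟨V, hV, hVK⟩ := compact_open_separated_mul_left
    (hK.isCompact.image (continuous_const_mul x)) (isClosed_tsupport (ι f)).isOpen_compl hxK
  have hVx : (· * x⁻¹) ⁻¹' V ∈ 𝓝 x :=
    (continuous_mul_const x⁻¹).continuousAt.preimage_mem_nhds (by simpa using hV)
  filter_upwards [hVx] with y hy
  refine apply_average_one_eq htrans hνK fun k hk => image_eq_zero_of_notMem_tsupport ?_
  have h := hVK (Set.mul_mem_mul hy ⟨k, hk, rfl⟩)
  simpa [mul_assoc] using h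

end Projection

variable [IsTopologicalGroup G] [CompactSpace G] [T2Space G] [CompleteSpace A]

/-- The heart of the proof: twisted averages of `f` over `K` approximate `f`, and each is a
combination, with coefficients in `A`, of invariant functions vanishing on `E*`. -/
theorem vanishing_subset_multiplesOfProducts (hι : Function.Injective ι) (hreg : IsRegularOn ι)
    (htrans : HasContinuousIsometricRightTranslations ι) (htrig : IsTrigPolyModule ι)
    (hK : IsClosed (K : Set G)) :
    vanishing ι {s : G | (s : G ⧸ K) ∈ E} ⊆ (multiplesOfProducts
      ((↑) '' vanishing (cosetMap ι K) E : Set A) 1 : Set A) := by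
  borelize G
  obtain ⟨ν, _, hν1, hνK, hνinv⟩ := exists_measure_of_isClosed_subgroup hK
  intro f hf
  refine Metric.mem_closure_iff.2 fun ε hε => ?_
  obtain ⟨t, ht, htf⟩ := exists_norm_average_sub_lt htrans ν hι hν1 f hε
  refine ⟨average htrans ν t f, ?_, by rwa [dist_eq_norm, norm_sub_rev]⟩
  clear htf
  induction ht using Submodule.span_induction with
  | mem t ht =>
    obtain ⟨n, π, hπ, i, j, rfl⟩ := ht
    choose a ha using fun l => exists_apply_eq_of_mem_trigPoly hreg htrans htrig
      (star_coeff_mem_trigPoly π hπ l i)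
    choose b hb using fun l => exists_apply_eq_of_mem_trigPoly hreg htrans htrig
      (coeff_mem_trigPoly π hπ l j)
    have h1 : average htrans ν (fun g => (π g : Matrix (Fin n) (Fin n) ℂ) i j) f =
        ∑ l, a l * average htrans ν 1 (b l * f) := by
      refine hι ?_
      ext x
      -- Unitarity separates the variables: a factor in `x` alone leaves the integral, and the
      -- factor in `xk` is absorbed into the translate of `b l * f`.
      have hcoef (k : G) : (π k : Matrix (Fin n) (Fin n) ℂ) i j =
          ∑ l, star ((π x : Matrix (Fin n) (Fin n) ℂ) l i) *
            (π (x * k) : Matrix (Fin n) (Fin n) ℂ) l j := by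
        have h2 : (π k : Matrix (Fin n) (Fin n) ℂ) =
            star (π x : Matrix (Fin n) (Fin n) ℂ) * (π (x * k) : Matrix (Fin n) (Fin n) ℂ) := by
          rw [map_mul, Submonoid.coe_mul, ← mul_assoc, Matrix.mem_unitaryGroup_iff'.1 (π x).2,
            one_mul]
        rw [h2, Matrix.mul_apply]
        rfl
      have hcont (l : Fin n) :
          Continuous fun g => (π g : Matrix (Fin n) (Fin n) ℂ) l j :=
        continuous_of_mem_trigPoly (coeff_mem_trigPoly π hπ l j)
      have hsum : ι (∑ l, a l * average htrans ν 1 (b l * f)) x =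
          ∑ l, ι (a l) x * ι (average htrans ν 1 (b l * f)) x := by
        rw [← evalCLM_apply, map_sum]
        simp [evalCLM_apply]
      rw [apply_average htrans ν (hcont i), hsum]
      simp_rw [hcoef, Finset.sum_mul, apply_average_one, ha, ← integral_const_mul]
      rw [integral_finsetSum _ fun l _ => integrable_of_continuous ν ?_]
      · simp [hb, mul_assoc]
      · have := hcont l
        fun_prop
    rw [h1]
    refine Submodule.sum_mem _ fun l _ => Submodule.subset_span ⟨a l, _, .one _ ?_, rfl⟩
    refine ⟨⟨average htrans ν 1 (b l * f), average_one_mem_rightInvariant htrans hνinv _⟩,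
      mem_vanishing_cosetMap.2 (average_one_mem_vanishing htrans hνK fun x hx => ?_), rfl⟩
    simp [hf x hx]
  | zero => simp [average]
  | add t u ht hu h h' =>
    have : average htrans ν (t + u) f = average htrans ν t f + average htrans ν u f := by
      have htc := continuous_of_mem_trigPoly ht
      have huc := continuous_of_mem_trigPoly hu
      simp_rw [average, Pi.add_apply, add_smul]
      exact integral_add (integrable_of_continuous ν (by fun_prop))
        (integrable_of_continuous ν (by fun_prop))
    rw [this]
    exact add_mem h h'
  | smul c t ht h =>
    have : average htrans ν (c • t) f = c • average htrans ν t f := by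
      simp_rw [average, Pi.smul_apply, smul_assoc]
      exact integral_smul _ _
    rw [this]
    exact Submodule.smul_mem _ c h

theorem isWeakSynthesis_cosetMap_iff [IsScalarTower ℂ A A] [SMulCommClass ℂ A A]
    (hι : Function.Injective ι) (hreg : IsRegularOn ι)
    (htrans : HasContinuousIsometricRightTranslations ι) (htrig : IsTrigPolyModule ι)
    (hK : IsClosed (K : Set G)) (hE : IsClosed E) {d : ℕ} (hd : 0 < d) :
    IsWeakSynthesis (cosetMap ι K) E d ↔ IsWeakSynthesis ι {s : G | (s : G ⧸ K) ∈ E} d := by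
  borelize G
  obtain ⟨ν, _, hν1, hνK, hνinv⟩ := exists_measure_of_isClosed_subgroup hK
  have hEG : IsClosed {s : G | (s : G ⧸ K) ∈ E} := hE.preimage QuotientGroup.continuous_mk
  rw [isWeakSynthesis_iff_closedPower_subset hι _ hd,
    isWeakSynthesis_iff_closedPower_subset (cosetMap_injective hι) _ hd]
  · constructor
    · intro h f hf
      have h1 := closedPower_subset_multiplesOfProducts
        (vanishing_subset_multiplesOfProducts hι hreg htrans htrig hK) d hf
      refine closure_minimal (t := closure (vanishingNear ι {s : G | (s : G ⧸ K) ∈ E})) ?_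
        isClosed_closure h1
      refine Submodule.span_le (p := (vanishingNearSubmodule ι
        {s : G | (s : G ⧸ K) ∈ E}).topologicalClosure).2 ?_
      rintro _ ⟨a, b, hb, rfl⟩
      obtain ⟨b', hb', rfl⟩ := exists_isProductOf_cosetMap hb
      refine mul_mem_closure_vanishingNear a ?_
      exact map_mem_closure continuous_subtype_val
        (h (subset_closure (Submodule.subset_span hb')))
        fun g hg => mem_vanishingNear_cosetMap.1 hg
    · intro h f hf
      -- Averaging over `K` fixes `f` and is contractive, so the average of an approximant from
      -- `I₀(E*)` is an invariant approximant, at least as good.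
      refine Metric.mem_closure_iff.2 fun ε hε => ?_
      obtain ⟨g, hg, hfg⟩ := Metric.mem_closure_iff.1 (h (coe_mem_closedPower_vanishing hf)) ε hε
      refine ⟨⟨average htrans ν 1 g, average_one_mem_rightInvariant htrans hνinv g⟩,
        mem_vanishingNear_cosetMap.2 (average_one_mem_vanishingNear htrans hK hνK hg), ?_⟩
      rw [dist_eq_norm] at hfg
      rw [Subtype.dist_eq, dist_eq_norm]
      have h1 := norm_average_one_sub_le htrans ν hι (f : A) g
      rw [average_one_eq_self htrans hι hνK f.2] at h1
      exact h1.trans_lt hfg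
  · intro C hC hCE
    -- Local units on `G/K`: separate the preimages in `G`, then average; these preimages are unions
    -- of cosets, so the values `1` and `0` survive.
    obtain ⟨u, hu1, hu0⟩ := exists_eqOn_one_eqOn_zero hreg htrans htrig
      (hC.preimage QuotientGroup.continuous_mk) hEG (hCE.preimage _)
    refine ⟨⟨average htrans ν 1 u, average_one_mem_rightInvariant htrans hνinv u⟩,
      mem_vanishing_cosetMap.2 (average_one_mem_vanishing htrans hνK hu0), fun x hx => ?_⟩
    induction x using QuotientGroup.induction_on with
    | H s =>
      refine apply_average_one_eq htrans hνK fun k hk => hu1 _ ?_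
      rwa [Set.mem_preimage, QuotientGroup.mk_mul_of_mem s hk]
  · intro C hC hCE
    obtain ⟨u, hu1, hu0⟩ := exists_eqOn_one_eqOn_zero hreg htrans htrig hC hEG hCE
    exact ⟨u, hu0, hu1⟩

end Quotient

end Synthesis

theorem theoremT
    {G : Type*} [Group G] [TopologicalSpace G] [IsTopologicalGroup G] [CompactSpace G] [T2Space G]
    {A : Type*} [NonUnitalNormedCommRing A] [NormedSpace ℂ A] [IsScalarTower ℂ A A]
    [SMulCommClass ℂ A A] [CompleteSpace A]
    (ι : A →ₙₐ[ℂ] C₀(G, ℂ)) (hι : Function.Injective ι)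
    (hreg : Synthesis.IsRegularOn ι)
    (htrans : Synthesis.HasContinuousIsometricRightTranslations ι)
    (htrig : Synthesis.IsTrigPolyModule ι)
    (K : Subgroup G) (hK : IsClosed (K : Set G))
    (E : Set (G ⧸ K)) (hE : IsClosed E) (d : ℕ) (hd : 0 < d) :
    (Synthesis.IsWeakSynthesis (Synthesis.cosetMap ι K) E d ↔
      Synthesis.IsWeakSynthesis ι {s : G | (s : G ⧸ K) ∈ E} d) ∧
    (Synthesis.IsLocalWeakSynthesis (Synthesis.cosetMap ι K) E d ↔
      Synthesis.IsLocalWeakSynthesis ι {s : G | (s : G ⧸ K) ∈ E} d) :=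
  have h := Synthesis.isWeakSynthesis_cosetMap_iff hι hreg htrans htrig hK hE hd
  ⟨h, (Synthesis.isLocalWeakSynthesis_cosetMap_iff_isWeakSynthesis d).trans
    (h.trans (Synthesis.isLocalWeakSynthesis_iff_isWeakSynthesis d _).symm)⟩
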